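/- For $x,p\in\mathbb{C}$ with $|p|<1$ write $(x;p)_n=\prod_{k=0}^{n-1}(1-xp^k)$ for $n=0,1,2,\dots$ and for $n=\infty$, and $(x_1,\dots,x_m;p)_n=(x_1;p)_n\cdots(x_m;p)_n$. Theorem T9. Let $q,a,b\in\mathbb{C}$ with $|q|<1$ and $\max\{|aq^2|,|bq^2|,|ab|\}<1$. Then $$ \begin{aligned} &\frac{(q^2,ab;q^2)_\infty}{(aq^2,bq^2;q^2)_\infty}\sum_{n=0}^\infty\frac{(q^2/a,q^2/b;q^2)_n}{(-q,q^2;q^2)_n\,(q;q^2)_{n+1}}\,a^nb^n\\ &\quad=\sum_{n=0}^\infty(-1)^n(1+q^{4n+1})\frac{(q^2/a,q^2/b;q^2)_{2n}}{(aq^2,bq^2;q^2)_{2n}}(ab)^{2n}q^{6n^2+2n}\\ &\qquad-\sum_{n=0}^\infty(-1)^n(1+q^{4n+3})\frac{(q^2/a,q^2/b;q^2)_{2n+1}}{(aq^2,bq^2;q^2)_{2n+1}}(ab)^{2n+1}q^{6n^2+6n+1}, \end{aligned} $$ where all three series converge absolutely. If $a=0$ or $b=0$, the identity holds with the expressions $(q^2/a;q^2)_m\,a^m$,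 respectively $(q^2/b;q^2)_m\,b^m$, replaced by their limits $(-1)^mq^{m(m+1)}$ as $a\to0$, respectively $b\to0$. -/

import Mathlib

open Filter Topology

/-- The finite `q`-shifted factorial `(x; p)_n = ∏_{k=0}^{n-1} (1 - x p^k)`. -/
def qShift (x p : ℂ) (n : ℕ) : ℂ := ∏ k ∈ Finset.range n, (1 - x * p ^ k)

/-- The infinite `q`-shifted factorial `(x; p)_∞ = ∏_{k=0}^∞ (1 - x p^k)`. -/
noncomputable def qShiftInf (x p : ℂ) : ℂ := ∏' k : ℕ, (1 - x * p ^ k)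

/-- The expression `(p/a; p)_n a^n`, extended to `a = 0` by its limit. It is written as the product
`∏_{k=0}^{n-1} (a - p^(k+1))`. The three lemmas below identify it with `(p/a; p)_n a^n` for
`a ≠ 0`, with the limit of that expression for `a = 0`, and give the limit explicitly. -/
def qShiftScaled (a p : ℂ) (n : ℕ) : ℂ := ∏ k ∈ Finset.range n, (a - p ^ (k + 1))

/-- The infinite product converges when `|p| < 1`. -/
theorem qShiftInf_multipliable (x : ℂ) {p : ℂ} (hp : ‖p‖ < 1) :
    Multipliable (fun k : ℕ => 1 - x * p ^ k) := by
  have h : Summable (fun k : ℕ => ‖-(x * p ^ k)‖) := by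
    simp only [norm_neg, norm_mul, norm_pow]
    exact (summable_geometric_of_lt_one (norm_nonneg p) hp).mul_left _
  simpa [sub_eq_add_neg] using multipliable_one_add_of_summable h

theorem qShiftScaled_of_ne_zero {a : ℂ} (ha : a ≠ 0) (p : ℂ) (n : ℕ) :
    qShiftScaled a p n = qShift (p / a) p n * a ^ n := by
  unfold qShiftScaled qShift
  induction n with
  | zero => simp
  | succ n ih =>
    have h : a - p ^ (n + 1) = (1 - p / a * p ^ n) * a := by
      field_simp
      ring
    rw [Finset.prod_range_succ, Finset.prod_range_succ, ih, h]
    ring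

theorem qShiftScaled_tendsto (p : ℂ) (n : ℕ) :
    Tendsto (fun a : ℂ => qShift (p / a) p n * a ^ n) (𝓝[≠] 0) (𝓝 (qShiftScaled 0 p n)) := by
  have hc : Continuous (fun a : ℂ => qShiftScaled a p n) := by
    unfold qShiftScaled
    fun_prop
  refine ((hc.tendsto 0).mono_left nhdsWithin_le_nhds).congr' ?_
  filter_upwards [self_mem_nhdsWithin] with a ha
  exact qShiftScaled_of_ne_zero ha p n

theorem qShiftScaled_zero (p : ℂ) (n : ℕ) :
    qShiftScaled 0 p n = (-1) ^ n * p ^ (n * (n + 1) / 2) := by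
  have h : n * (n + 1) / 2 = ∑ k ∈ Finset.range n, (k + 1) := by
    have := Finset.sum_range_succ' (fun k : ℕ => k) n
    have h2 := Finset.sum_range_id (n + 1)
    simp only [Nat.add_sub_cancel] at h2
    rw [mul_comm, ← h2, this, add_zero]
  rw [h, ← Finset.prod_pow_eq_pow_sum]
  simp [qShiftScaled, Finset.prod_neg]

/-! Put `p = q²` and `D_N(x) = ∏_{k<N} (x - p^(k+1))`, a polynomial in `x`, so that `a = 0` and `b =
0` need no separate treatment. The proof is Bailey's transform: a Bailey pair with `a, b` absent,
combined with the `q`-Gauss sum.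

The pair (`tsum_slaterAlpha`) writes `β_N = 1 / ((-q, p; p)_N (q; p)_{N+1})` as `∑_r α_r / ((p;
p)_{N-r} (p; p)_{N+r+1})`. Interlacing the even and odd `r` turns this into a sum over all integers
with quadratic exponents. The `q`-Pascal rule and the reflections `n ↦ -n`, `n ↦ -1 - n` give
first-order recurrences in `N` for such sums, hence the closed form.

Multiplying by `D_N(a) D_N(b)` and summing over `N` gives an absolutely convergent double series.
For fixed `r`, its sum over `N ≥ r` is a `q`-Gauss series (`tsum_qGaussTerm`); exchanging the sums
gives a single series in `α_r`, which is split by the parity of `r`. -/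

/-! ### Reciprocal `q`-factorials and the `q`-Pascal rule -/

/-- The reciprocal `1 / (p; p)_k`, extended by zero to negative `k`. -/
noncomputable def qFactInv (p : ℂ) (k : ℤ) : ℂ := if 0 ≤ k then (qShift p p k.toNat)⁻¹ else 0

theorem qShift_zero (x p : ℂ) : qShift x p 0 = 1 := by simp [qShift]

theorem qShift_succ (x p : ℂ) (n : ℕ) :
    qShift x p (n + 1) = qShift x p n * (1 - x * p ^ n) := by
  simp [qShift, Finset.prod_range_succ]

theorem qShift_add (x p : ℂ) (m n : ℕ) :
    qShift x p (m + n) = qShift x p m * qShift (x * p ^ m) p n := by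
  simp only [qShift, Finset.prod_range_add, pow_add, mul_assoc]

theorem qShift_succ' (x p : ℂ) (n : ℕ) :
    qShift x p (n + 1) = (1 - x) * qShift (x * p) p n := by
  rw [add_comm, qShift_add]
  simp [qShift]

theorem one_sub_mul_pow_ne_zero {x p : ℂ} (hx : ‖x‖ < 1) (hp : ‖p‖ < 1) (n : ℕ) :
    1 - x * p ^ n ≠ 0 := by
  intro h
  have h1 : ‖x * p ^ n‖ = 1 := by rw [← sub_eq_zero.mp h, norm_one]
  have h2 : ‖x * p ^ n‖ ≤ ‖x‖ * 1 := by
    rw [norm_mul, norm_pow]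
    gcongr
    exact pow_le_one₀ (norm_nonneg p) hp.le
  linarith

theorem one_sub_pow_succ_ne_zero {p : ℂ} (hp : ‖p‖ < 1) (n : ℕ) : 1 - p ^ (n + 1) ≠ 0 := by
  have := one_sub_mul_pow_ne_zero hp hp n
  rwa [← pow_succ'] at this

theorem qShift_ne_zero {x p : ℂ} (hx : ‖x‖ < 1) (hp : ‖p‖ < 1) (n : ℕ) : qShift x p n ≠ 0 :=
  Finset.prod_ne_zero_iff.mpr fun k _ => one_sub_mul_pow_ne_zero hx hp k

theorem qFactInv_natCast (p : ℂ) (n : ℕ) : qFactInv p n = (qShift p p n)⁻¹ := by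
  simp [qFactInv]

theorem qFactInv_of_neg (p : ℂ) {k : ℤ} (hk : k < 0) : qFactInv p k = 0 := by
  simp [qFactInv, hk]

/-- No sign condition on `k` is needed: both sides vanish for `k < 0`, and at `k = 0` the factor `1
- p^0` matches the extension by zero. -/
theorem qFactInv_sub_one {p : ℂ} (hp : ‖p‖ < 1) (k : ℤ) :
    qFactInv p (k - 1) = (1 - p ^ k.toNat) * qFactInv p k := by
  rcases lt_trichotomy k 0 with hk | rfl | hk
  · rw [qFactInv_of_neg p hk, qFactInv_of_neg p (by omega), mul_zero]
  · simp [qFactInv]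
  · obtain ⟨n, rfl⟩ : ∃ n : ℕ, k = (n + 1 : ℕ) := ⟨(k - 1).toNat, by omega⟩
    have h1 := one_sub_pow_succ_ne_zero hp n
    have h2 := qShift_ne_zero hp hp n
    have h3 : ((n + 1 : ℕ) : ℤ) - 1 = (n : ℕ) := by push_cast; ring
    rw [h3, qFactInv_natCast, qFactInv_natCast, qShift_succ, Int.toNat_natCast, ← pow_succ']
    field_simp

/-- The `q`-Pascal rule, for the products `1 / ((p; p)_j (p; p)_k)`. -/
theorem qFactInv_pascal {p : ℂ} (hp : ‖p‖ < 1) {j k : ℤ} {m : ℕ} (h : j + k = m) :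
    (1 - p ^ m) * (qFactInv p j * qFactInv p k) =
      qFactInv p (j - 1) * qFactInv p k + p ^ j.toNat * qFactInv p j * qFactInv p (k - 1) := by
  rcases lt_or_ge j 0 with hj | hj
  · rw [qFactInv_of_neg p hj, qFactInv_of_neg p (show j - 1 < 0 by omega)]
    ring
  rcases lt_or_ge k 0 with hk | hk
  · rw [qFactInv_of_neg p hk, qFactInv_of_neg p (show k - 1 < 0 by omega)]
    ring
  -- The rule is now `1 - p^(j+k) = (1 - p^j) + p^j (1 - p^k)`.
  have hm : m = j.toNat + k.toNat := by omega
  rw [qFactInv_sub_one hp, qFactInv_sub_one hp, hm, pow_add]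
  ring

/-! ### Bilateral sums and their recurrences in `N` -/

/-- The weights `(-1)^n p^(3n²+n)` for integers `n`. -/
def slaterWeight (p : ℂ) (n : ℤ) : ℂ := (-1) ^ n.natAbs * p ^ (3 * n ^ 2 + n).toNat

/-- The weights `(-1)^n p^(3n²+3n)` for integers `n`. -/
def slaterWeight' (p : ℂ) (n : ℤ) : ℂ := (-1) ^ n.natAbs * p ^ (3 * n ^ 2 + 3 * n).toNat

theorem summable_mul_qFactInv (p : ℂ) (w : ℤ → ℂ) (N M : ℤ) :
    Summable fun n : ℤ => w n * (qFactInv p (N - 2 * n) * qFactInv p (M + 2 * n)) := by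
  refine summable_of_ne_finset_zero (s := Finset.Icc (-|M|) |N|) fun n hn => ?_
  rw [Finset.mem_Icc, not_and_or, not_le, not_le] at hn
  have hM := le_abs_self M
  have hN := le_abs_self N
  have hM0 := abs_nonneg M
  have hN0 := abs_nonneg N
  rcases hn with hn | hn
  · rw [qFactInv_of_neg p (show M + 2 * n < 0 by omega)]
    ring
  · rw [qFactInv_of_neg p (show N - 2 * n < 0 by omega)]
    ring

theorem three_sq_add_nonneg (n : ℤ) : 0 ≤ 3 * n ^ 2 + n := by
  rcases le_or_gt 0 n with h | h <;> nlinarith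

theorem three_sq_add_three_nonneg (n : ℤ) : 0 ≤ 3 * n ^ 2 + 3 * n := by
  rcases le_or_gt 0 n with h | h <;> nlinarith

/-- The extra power produced by the Pascal rule exchanges the two weights: `(3n² + n) + (N + 1 + 2n)
= (N + 1) + (3n² + 3n)`. Where `toNat` truncates, `qFactInv` vanishes. The next two lemmas work in
the same way. -/
theorem slaterWeight_mul_pow (p : ℂ) (N : ℕ) (n : ℤ) (X : ℂ) :
    slaterWeight p n * (p ^ (N + 1 + 2 * n : ℤ).toNat * qFactInv p (N + 1 + 2 * n) * X) =
      p ^ (N + 1) * (slaterWeight' p n * (qFactInv p (N + 1 + 2 * n) * X)) := by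
  rcases lt_or_ge (N + 1 + 2 * n : ℤ) 0 with h | h
  · rw [qFactInv_of_neg p h]
    ring
  have h1 := three_sq_add_nonneg n
  have h2 := three_sq_add_three_nonneg n
  have h3 : p ^ (3 * n ^ 2 + n).toNat * p ^ (N + 1 + 2 * n : ℤ).toNat =
      p ^ (N + 1) * p ^ (3 * n ^ 2 + 3 * n).toNat := by
    rw [← pow_add, ← pow_add]
    congr 1
    omega
  unfold slaterWeight slaterWeight'
  linear_combination (-1) ^ n.natAbs * qFactInv p (N + 1 + 2 * n) * X * h3

theorem slaterWeight'_mul_pow (p : ℂ) (N : ℕ) (n : ℤ) (X : ℂ) :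
    slaterWeight' p n * (p ^ (N - 2 * n : ℤ).toNat * qFactInv p (N - 2 * n) * X) =
      p ^ N * (slaterWeight p n * (qFactInv p (N - 2 * n) * X)) := by
  rcases lt_or_ge (N - 2 * n : ℤ) 0 with h | h
  · rw [qFactInv_of_neg p h]
    ring
  have h1 := three_sq_add_nonneg n
  have h2 := three_sq_add_three_nonneg n
  have h3 : p ^ (3 * n ^ 2 + 3 * n).toNat * p ^ (N - 2 * n : ℤ).toNat =
      p ^ N * p ^ (3 * n ^ 2 + n).toNat := by
    rw [← pow_add, ← pow_add]
    congr 1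
    omega
  unfold slaterWeight slaterWeight'
  linear_combination (-1) ^ n.natAbs * qFactInv p (N - 2 * n) * X * h3

theorem slaterWeight_mul_pow_neg (p : ℂ) (N : ℕ) (n : ℤ) (X : ℂ) :
    slaterWeight p n * (p ^ (N - 2 * n : ℤ).toNat * qFactInv p (N - 2 * n) * X) =
      p ^ N * (slaterWeight p (-n) * (qFactInv p (N - 2 * n) * X)) := by
  rcases lt_or_ge (N - 2 * n : ℤ) 0 with h | h
  · rw [qFactInv_of_neg p h]
    ring
  have h1 := three_sq_add_nonneg n
  have h2 := three_sq_add_nonneg (-n)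
  have h3 : p ^ (3 * n ^ 2 + n).toNat * p ^ (N - 2 * n : ℤ).toNat =
      p ^ N * p ^ (3 * (-n) ^ 2 + -n).toNat := by
    rw [← pow_add, ← pow_add]
    congr 1
    rw [neg_sq] at h2 ⊢
    omega
  unfold slaterWeight
  rw [Int.natAbs_neg]
  linear_combination (-1) ^ n.natAbs * qFactInv p (N - 2 * n) * X * h3

/-- The map `n ↦ -1 - n` fixes `3n² + 3n = 3n(n + 1)` and changes the parity of `n`. -/
theorem slaterWeight'_reflect (p : ℂ) (n : ℤ) : slaterWeight' p (-1 - n) = -slaterWeight' p n := by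
  unfold slaterWeight'
  have h1 : (3 * (-1 - n) ^ 2 + 3 * (-1 - n)) = 3 * n ^ 2 + 3 * n := by ring
  have h2 : (-1 : ℂ) ^ (-1 - n).natAbs = -(-1) ^ n.natAbs := by
    rcases le_or_gt 0 n with h | h
    · rw [show (-1 - n).natAbs = n.natAbs + 1 by omega, pow_succ]
      ring
    · rw [show n.natAbs = (-1 - n).natAbs + 1 by omega, pow_succ]
      ring
  rw [h1, h2]
  ring

/-- The antisymmetry of `slaterWeight'` makes its symmetric sums vanish. -/
theorem tsum_slaterWeight'_eq_zero (p : ℂ) (N M : ℤ) (h : M = N + 1 + 1) :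
    ∑' n : ℤ, slaterWeight' p n * (qFactInv p (N - 2 * n) * qFactInv p (M + 2 * n)) = 0 := by
  set S := ∑' n : ℤ, slaterWeight' p n * (qFactInv p (N - 2 * n) * qFactInv p (M + 2 * n)) with hS
  have : S = -S := by
    -- Since `M = N + 2`, the reflection `n ↦ -1 - n` also swaps the two reciprocal factors.
    conv_lhs => rw [hS, ← (Equiv.subLeft (-1 : ℤ)).tsum_eq]
    rw [hS, ← tsum_neg]
    refine tsum_congr fun n => ?_
    rw [Equiv.subLeft_apply, slaterWeight'_reflect, show N - 2 * (-1 - n) = M + 2 * n by omega,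
      show M + 2 * (-1 - n) = N - 2 * n by omega]
    ring
  linear_combination this / 2

/-- `∑ (-1)^n p^(3n²+n) / ((p; p)_{N-2n} (p; p)_{N+1+2n})`. -/
noncomputable def slaterOdd (p : ℂ) (N : ℕ) : ℂ :=
  ∑' n : ℤ, slaterWeight p n * (qFactInv p (N - 2 * n) * qFactInv p (N + 1 + 2 * n))

/-- `∑ (-1)^n p^(3n²+3n) / ((p; p)_{N-2n} (p; p)_{N+1+2n})`. -/
noncomputable def slaterOdd' (p : ℂ) (N : ℕ) : ℂ :=
  ∑' n : ℤ, slaterWeight' p n * (qFactInv p (N - 2 * n) * qFactInv p (N + 1 + 2 * n))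

/-- `∑ (-1)^n p^(3n²+n) / ((p; p)_{N-2n} (p; p)_{N+2n})`. -/
noncomputable def slaterEven (p : ℂ) (N : ℕ) : ℂ :=
  ∑' n : ℤ, slaterWeight p n * (qFactInv p (N - 2 * n) * qFactInv p (N + 2 * n))

/-- The Pascal rule lowers one of the two indices. Lowering `N + 1 + 2n` gives the even sum;
lowering `N - 2n` gives a `slaterWeight'` sum that vanishes by antisymmetry. -/
theorem slaterOdd_eq {p : ℂ} (hp : ‖p‖ < 1) (N : ℕ) :
    (1 - p ^ (2 * N + 1)) * slaterOdd p N = slaterEven p N := by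
  have key : ∀ n : ℤ, (1 - p ^ (2 * N + 1)) *
      (slaterWeight p n * (qFactInv p (N - 2 * n) * qFactInv p (N + 1 + 2 * n))) =
      slaterWeight p n * (qFactInv p (N - 2 * n) * qFactInv p (N + 2 * n)) +
      p ^ (N + 1) * (slaterWeight' p n *
        (qFactInv p ((N - 1 : ℤ) - 2 * n) * qFactInv p (N + 1 + 2 * n))) := by
    intro n
    have h1 := qFactInv_pascal hp (j := N + 1 + 2 * n) (k := N - 2 * n) (m := 2 * N + 1)
      (by push_cast; ring)
    rw [show (N + 1 + 2 * n - 1 : ℤ) = N + 2 * n by ring,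
      show (N - 2 * n - 1 : ℤ) = (N - 1 : ℤ) - 2 * n by ring] at h1
    have h2 := slaterWeight_mul_pow p N n (qFactInv p ((N - 1 : ℤ) - 2 * n))
    linear_combination slaterWeight p n * h1 + h2
  rw [slaterOdd, ← tsum_mul_left, tsum_congr key,
    (summable_mul_qFactInv p _ _ _).tsum_add ((summable_mul_qFactInv p _ _ _).mul_left _),
    tsum_mul_left, tsum_slaterWeight'_eq_zero p _ _ (by ring), mul_zero, add_zero, slaterEven]

/-- The Pascal rule is applied with the two factors exchanged, so that the power `p^(N-2n)` falls on
the surviving term and the other one vanishes by antisymmetry. -/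
theorem slaterOdd'_eq {p : ℂ} (hp : ‖p‖ < 1) (N : ℕ) :
    (1 - p ^ (2 * N + 1)) * slaterOdd' p N = p ^ N * slaterEven p N := by
  have key : ∀ n : ℤ, (1 - p ^ (2 * N + 1)) *
      (slaterWeight' p n * (qFactInv p (N - 2 * n) * qFactInv p (N + 1 + 2 * n))) =
      slaterWeight' p n * (qFactInv p ((N - 1 : ℤ) - 2 * n) * qFactInv p (N + 1 + 2 * n)) +
      p ^ N * (slaterWeight p n * (qFactInv p (N - 2 * n) * qFactInv p (N + 2 * n))) := by
    intro n
    have h1 := qFactInv_pascal hp (j := N - 2 * n) (k := N + 1 + 2 * n) (m := 2 * N + 1)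
      (by push_cast; ring)
    rw [show (N + 1 + 2 * n - 1 : ℤ) = N + 2 * n by ring,
      show (N - 2 * n - 1 : ℤ) = (N - 1 : ℤ) - 2 * n by ring] at h1
    have h2 := slaterWeight'_mul_pow p N n (qFactInv p (N + 2 * n))
    linear_combination slaterWeight' p n * h1 + h2
  rw [slaterOdd', ← tsum_mul_left, tsum_congr key,
    (summable_mul_qFactInv p _ _ _).tsum_add ((summable_mul_qFactInv p _ _ _).mul_left _),
    tsum_mul_left, tsum_slaterWeight'_eq_zero p _ _ (by ring), zero_add, slaterEven]

/-- Both Pascal terms give the same odd sum, the second after `n ↦ -n`. -/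
theorem slaterEven_succ {p : ℂ} (hp : ‖p‖ < 1) (N : ℕ) :
    (1 - p ^ (2 * N + 2)) * slaterEven p (N + 1) = (1 + p ^ (N + 1)) * slaterOdd p N := by
  have key : ∀ n : ℤ, (1 - p ^ (2 * N + 2)) *
      (slaterWeight p n * (qFactInv p ((N + 1 : ℕ) - 2 * n) * qFactInv p ((N + 1 : ℕ) + 2 * n))) =
      slaterWeight p n * (qFactInv p (N - 2 * n) * qFactInv p (N + 1 + 2 * n)) +
      p ^ (N + 1) * (slaterWeight p (-n) *
        (qFactInv p (N + 1 - 2 * n) * qFactInv p (N + 2 * n))) := by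
    intro n
    have h1 := qFactInv_pascal hp (j := (N + 1 : ℕ) - 2 * n) (k := (N + 1 : ℕ) + 2 * n)
      (m := 2 * N + 2) (by push_cast; ring)
    have h2 := slaterWeight_mul_pow_neg p (N + 1) n (qFactInv p (N + 2 * n))
    push_cast at h1 h2 ⊢
    rw [show (N + 1 + 2 * n - 1 : ℤ) = N + 2 * n by ring,
      show (N + 1 - 2 * n - 1 : ℤ) = N - 2 * n by ring] at h1
    linear_combination slaterWeight p n * h1 + h2
  have hrefl : ∑' n : ℤ, slaterWeight p (-n) *
      (qFactInv p (N + 1 - 2 * n) * qFactInv p (N + 2 * n)) = slaterOdd p N := by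
    rw [slaterOdd, ← (Equiv.neg ℤ).tsum_eq]
    refine tsum_congr fun n => ?_
    rw [Equiv.neg_apply, neg_neg, show (N + 1 - 2 * -n : ℤ) = N + 1 + 2 * n by ring,
      show (N + 2 * -n : ℤ) = N - 2 * n by ring]
    ring
  rw [slaterEven, ← tsum_mul_left, tsum_congr key,
    (summable_mul_qFactInv p _ _ _).tsum_add ((summable_mul_qFactInv p _ _ _).mul_left _),
    tsum_mul_left, hrefl, ← slaterOdd]
  ring

theorem slaterEven_zero (p : ℂ) : slaterEven p 0 = 1 := by
  rw [slaterEven, tsum_eq_single 0]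
  · simp [slaterWeight, qFactInv, qShift]
  · intro n hn
    rcases lt_or_gt_of_ne hn with h | h
    · rw [qFactInv_of_neg p (show (0 : ℕ) + 2 * n < 0 by omega)]
      ring
    · rw [qFactInv_of_neg p (show (0 : ℕ) - 2 * n < 0 by omega)]
      ring

/-- The two recurrences combine into one from `N` to `N + 1`. Its factors split because `p = q²`: `1
- p^(2N+3) = (1 - q^(2N+3)) (1 + q^(2N+3))` and `1 - p^(2N+2) = (1 - p^(N+1)) (1 + p^(N+1))`. -/
theorem slaterOdd_closed {q : ℂ} (hq : ‖q‖ < 1) (N : ℕ) :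
    (1 + q ^ (2 * N + 1)) * slaterOdd (q ^ 2) N =
      1 / (qShift (-q) (q ^ 2) N * qShift (q ^ 2) (q ^ 2) N * qShift q (q ^ 2) (N + 1)) := by
  have hp : ‖q ^ 2‖ < 1 := by
    rw [norm_pow]
    exact pow_lt_one₀ (norm_nonneg q) hq two_ne_zero
  have hnq : ‖-q‖ < 1 := by rwa [norm_neg]
  induction N with
  | zero =>
    have h := slaterOdd_eq hp 0
    rw [slaterEven_zero] at h
    have h1 := one_sub_pow_succ_ne_zero hq 0
    simp only [qShift, Finset.range_zero, Finset.prod_empty, zero_add, Finset.prod_range_one]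
    rw [eq_div_iff (by simpa using h1)]
    linear_combination h
  | succ N ih =>
    have h1 := slaterOdd_eq hp (N + 1)
    have h2 := slaterEven_succ hp N
    have e1 := qShift_ne_zero hnq hp N
    have e2 := qShift_ne_zero hp hp N
    have e3 := qShift_ne_zero hq hp (N + 1)
    have f1 := one_sub_mul_pow_ne_zero hnq hp N
    have f2 := one_sub_mul_pow_ne_zero hp hp N
    have f3 := one_sub_mul_pow_ne_zero hq hp (N + 1)
    have g1 := one_sub_pow_succ_ne_zero hp (2 * N + 1)
    rw [qShift_succ (-q), qShift_succ (q ^ 2), qShift_succ q _ (N + 1)]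
    rw [eq_div_iff (by simp [e1, e2, e3])] at ih
    rw [eq_div_iff (by simp only [ne_eq, mul_eq_zero, not_or]; tauto)]
    apply mul_left_cancel₀ g1
    linear_combination
      (1 - (q ^ 2) ^ (2 * N + 2)) * (1 - -q * (q ^ 2) ^ N) * (1 - q ^ 2 * (q ^ 2) ^ N) *
        (qShift (-q) (q ^ 2) N * qShift (q ^ 2) (q ^ 2) N * qShift q (q ^ 2) (N + 1)) * h1 +
      (1 - -q * (q ^ 2) ^ N) * (1 - q ^ 2 * (q ^ 2) ^ N) *
        (qShift (-q) (q ^ 2) N * qShift (q ^ 2) (q ^ 2) N * qShift q (q ^ 2) (N + 1)) * h2 +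
      (1 - q ^ 2 * (q ^ 2) ^ N) * (1 + (q ^ 2) ^ (N + 1)) * ih

/-! ### The Bailey pair -/

/-- The coefficients `α_{2n} = (-1)^n (1 + q^(4n+1)) q^(6n²+2n)` and
`α_{2n+1} = -(-1)^n (1 + q^(4n+3)) q^(6n²+6n+1)`. -/
noncomputable def slaterAlpha (q : ℂ) (r : ℕ) : ℂ :=
  if Even r then (-1) ^ (r / 2) * (1 + q ^ (4 * (r / 2) + 1)) * q ^ (6 * (r / 2) ^ 2 + 2 * (r / 2))
  else -((-1) ^ (r / 2) * (1 + q ^ (4 * (r / 2) + 3)) * q ^ (6 * (r / 2) ^ 2 + 6 * (r / 2) + 1))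

theorem slaterAlpha_even (q : ℂ) (n : ℕ) :
    slaterAlpha q (2 * n) = (-1) ^ n * (1 + q ^ (4 * n + 1)) * q ^ (6 * n ^ 2 + 2 * n) := by
  simp [slaterAlpha]

theorem slaterAlpha_odd (q : ℂ) (n : ℕ) :
    slaterAlpha q (2 * n + 1) =
      -((-1) ^ n * (1 + q ^ (4 * n + 3)) * q ^ (6 * n ^ 2 + 6 * n + 1)) := by
  have h : (2 * n + 1) / 2 = n := by omega
  simp [slaterAlpha, h]

/-- The Bailey pair with respect to `q²`, in base `q²`. -/
theorem tsum_slaterAlpha {q : ℂ} (hq : ‖q‖ < 1) (N : ℕ) :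
    ∑' r : ℕ, slaterAlpha q r * (qFactInv (q ^ 2) (N - r) * qFactInv (q ^ 2) (N + r + 1)) =
      1 / (qShift (-q) (q ^ 2) N * qShift (q ^ 2) (q ^ 2) N * qShift q (q ^ 2) (N + 1)) := by
  set p := q ^ 2 with hp'
  have hp : ‖p‖ < 1 := by
    rw [hp', norm_pow]
    exact pow_lt_one₀ (norm_nonneg q) hq two_ne_zero
  have hB : slaterOdd' p N = p ^ N * slaterOdd p N := by
    have h1 := slaterOdd_eq hp N
    have h2 := slaterOdd'_eq hp N
    apply mul_left_cancel₀ (one_sub_pow_succ_ne_zero hp (2 * N))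
    linear_combination h2 - p ^ N * h1
  -- The integers `n ≥ 0` carry the indices `r = 2n`, and `-(n + 1)` carries `r = 2n + 1`. In each
  -- case the two weights supply the two terms of the factor `1 + q^(2r+1)` in `slaterAlpha`.
  set f : ℤ → ℂ := fun n => (slaterWeight p n + q * slaterWeight' p n) *
    (qFactInv p (N - 2 * n) * qFactInv p (N + 1 + 2 * n)) with hf
  set g : ℕ → ℂ := fun r => slaterAlpha q r * (qFactInv p (N - r) * qFactInv p (N + r + 1)) with hg
  have hsum : ∑' n : ℤ, f n = (1 + q ^ (2 * N + 1)) * slaterOdd p N := by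
    have : ∀ n, f n = slaterWeight p n * (qFactInv p (N - 2 * n) * qFactInv p (N + 1 + 2 * n)) +
        q * (slaterWeight' p n * (qFactInv p (N - 2 * n) * qFactInv p (N + 1 + 2 * n))) := by
      intro n
      simp only [hf]
      ring
    rw [tsum_congr this,
      (summable_mul_qFactInv p _ _ _).tsum_add ((summable_mul_qFactInv p _ _ _).mul_left _),
      tsum_mul_left, ← slaterOdd, ← slaterOdd', hB, hp']
    ring
  have hsf : Summable f := summable_mul_qFactInv p _ _ _
  have hnat {k : ℤ} {m : ℕ} (h : k = m) : k.toNat = m := by rw [h, Int.toNat_natCast]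
  have heven : ∀ n : ℕ, f n = g (2 * n) := by
    intro n
    simp only [hf, hg, slaterAlpha_even, slaterWeight, slaterWeight', hp']
    rw [hnat (show 3 * (n : ℤ) ^ 2 + n = (3 * n ^ 2 + n : ℕ) by push_cast; ring),
      hnat (show 3 * (n : ℤ) ^ 2 + 3 * n = (3 * n ^ 2 + 3 * n : ℕ) by push_cast; ring),
      Int.natAbs_natCast, Nat.cast_mul, Nat.cast_ofNat, ← hp',
      show (N + 1 + 2 * n : ℤ) = N + 2 * n + 1 by ring, hp']
    ring
  have hodd : ∀ n : ℕ, f (-(n + 1)) = g (2 * n + 1) := by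
    intro n
    simp only [hf, hg, slaterAlpha_odd, slaterWeight, slaterWeight', hp']
    rw [hnat (show 3 * (-(n + 1 : ℤ)) ^ 2 + -(n + 1 : ℤ) = (3 * n ^ 2 + 5 * n + 2 : ℕ) by
        push_cast; ring),
      hnat (show 3 * (-(n + 1 : ℤ)) ^ 2 + 3 * -(n + 1 : ℤ) = (3 * n ^ 2 + 3 * n : ℕ) by
        push_cast; ring),
      show (-(n + 1 : ℤ)).natAbs = n + 1 by omega, ← hp',
      show (N - 2 * -(n + 1 : ℤ)) = N + (2 * n + 1 : ℕ) + 1 by push_cast; ring,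
      show (N + 1 + 2 * -(n + 1 : ℤ)) = N - (2 * n + 1 : ℕ) by push_cast; ring, hp']
    ring
  have hinj : Function.Injective fun n : ℕ => (-(n + 1) : ℤ) := by
    intro m n h
    simpa using h
  have hs1 : Summable fun n : ℕ => f n := hsf.comp_injective Nat.cast_injective
  have hs2 : Summable fun n : ℕ => f (-(n + 1)) := hsf.comp_injective hinj
  rw [← slaterOdd_closed hq, ← hsum, tsum_of_nat_of_neg_add_one hs1 hs2, tsum_congr heven,
    tsum_congr hodd, tsum_even_add_odd]
  · exact hs1.congr heven
  · exact hs2.congr hodd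

/-! ### Growth bounds and infinite products -/

/-- Ratio test with an explicit rate: once `‖c n‖ < ρ`, the quotients `‖x n‖ / ρ^n` no longer
increase. -/
theorem exists_norm_le_mul_pow {x c : ℕ → ℂ} {l : ℂ} {ρ : ℝ} (hx : ∀ n, x (n + 1) = c n * x n)
    (hc : Tendsto c atTop (𝓝 l)) (hl : ‖l‖ < ρ) : ∃ K, 0 ≤ K ∧ ∀ n, ‖x n‖ ≤ K * ρ ^ n := by
  have hρ : 0 < ρ := (norm_nonneg l).trans_lt hl
  obtain ⟨N, hN⟩ := eventually_atTop.mp (hc.norm.eventually_lt_const hl)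
  have hanti : ∀ n, N ≤ n → ‖x n‖ / ρ ^ n ≤ ‖x N‖ / ρ ^ N := by
    intro n hn
    induction n, hn using Nat.le_induction with
    | base => exact le_rfl
    | succ n hn ih =>
      refine le_trans ?_ ih
      rw [hx, norm_mul, pow_succ', div_le_div_iff₀ (by positivity) (by positivity)]
      have := (hN n hn).le
      have h0 : 0 ≤ ‖x n‖ * ρ ^ n := by positivity
      nlinarith
  -- The sum is a convenient upper bound for the finitely many initial quotients.
  refine ⟨∑ n ∈ Finset.range (N + 1), ‖x n‖ / ρ ^ n, by positivity, fun n => ?_⟩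
  rw [← div_le_iff₀ (by positivity)]
  have hle : ∀ m ∈ Finset.range (N + 1), ‖x m‖ / ρ ^ m ≤
      ∑ n ∈ Finset.range (N + 1), ‖x n‖ / ρ ^ n := fun m hm =>
    Finset.single_le_sum (f := fun n => ‖x n‖ / ρ ^ n) (fun i _ => by positivity) hm
  rcases le_or_gt n N with h | h
  · exact hle n (Finset.mem_range.mpr (by omega))
  · exact (hanti n h.le).trans (hle N (by simp))

theorem tendsto_qShift (x : ℂ) {p : ℂ} (hp : ‖p‖ < 1) :
    Tendsto (qShift x p) atTop (𝓝 (qShiftInf x p)) :=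
  (qShiftInf_multipliable x hp).tendsto_prod_tprod_nat

theorem qShiftInf_eq_mul (x : ℂ) {p : ℂ} (hp : ‖p‖ < 1) (n : ℕ) :
    qShiftInf x p = qShift x p n * qShiftInf (x * p ^ n) p := by
  refine tendsto_nhds_unique ((tendsto_qShift x hp).comp (tendsto_add_atTop_nat n)) ?_
  refine ((tendsto_qShift (x * p ^ n) hp).const_mul (qShift x p n)).congr fun m => ?_
  rw [Function.comp_apply, add_comm, qShift_add]

theorem qShiftInf_ne_zero {x p : ℂ} (hx : ‖x‖ < 1) (hp : ‖p‖ < 1) : qShiftInf x p ≠ 0 := by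
  have h : Summable (fun k : ℕ => ‖-(x * p ^ k)‖) := by
    simp only [norm_neg, norm_mul, norm_pow]
    exact (summable_geometric_of_lt_one (norm_nonneg p) hp).mul_left _
  have := tprod_one_add_ne_zero_of_summable (f := fun k : ℕ => -(x * p ^ k))
    (fun k => by simpa [sub_eq_add_neg] using one_sub_mul_pow_ne_zero hx hp k) h
  simpa [qShiftInf, sub_eq_add_neg] using this

theorem exists_norm_qShift_le (x : ℂ) {p : ℂ} (hp : ‖p‖ < 1) :
    ∃ K, 0 ≤ K ∧ ∀ n, ‖qShift x p n‖ ≤ K := by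
  obtain ⟨K, hK⟩ := (tendsto_qShift x hp).norm.bddAbove_range
  exact ⟨K, (norm_nonneg _).trans (hK ⟨0, rfl⟩), fun n => hK ⟨n, rfl⟩⟩

theorem exists_norm_inv_qShift_le {x p : ℂ} (hx : ‖x‖ < 1) (hp : ‖p‖ < 1) :
    ∃ K, 0 ≤ K ∧ ∀ n, ‖(qShift x p n)⁻¹‖ ≤ K := by
  obtain ⟨K, hK⟩ := ((tendsto_qShift x hp).inv₀ (qShiftInf_ne_zero hx hp)).norm.bddAbove_range
  exact ⟨K, (norm_nonneg _).trans (hK ⟨0, rfl⟩), fun n => hK ⟨n, rfl⟩⟩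

theorem exists_norm_qFactInv_le {p : ℂ} (hp : ‖p‖ < 1) :
    ∃ K, 0 ≤ K ∧ ∀ k, ‖qFactInv p k‖ ≤ K := by
  obtain ⟨K, hK0, hK⟩ := exists_norm_inv_qShift_le hp hp
  refine ⟨K, hK0, fun k => ?_⟩
  unfold qFactInv
  split_ifs
  · exact hK _
  · simpa using hK0

/-! ### The `q`-Gauss sum in homogeneous form -/

/-- The homogeneous `q`-shifted factorial `∏_{k=0}^{n-1} (a - u p^k)`, which is `a^n (u/a; p)_n`
for `a ≠ 0`. -/
def qShiftHom (a u p : ℂ) (n : ℕ) : ℂ := ∏ k ∈ Finset.range n, (a - u * p ^ k)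

theorem qShiftHom_zero (a u p : ℂ) : qShiftHom a u p 0 = 1 := by simp [qShiftHom]

theorem qShiftHom_succ (a u p : ℂ) (n : ℕ) :
    qShiftHom a u p (n + 1) = (a - u * p ^ n) * qShiftHom a u p n := by
  rw [qShiftHom, Finset.prod_range_succ, mul_comm, qShiftHom]

theorem qShiftHom_mul (a u p c : ℂ) (n : ℕ) :
    qShiftHom (a * c) (u * c) p n = c ^ n * qShiftHom a u p n := by
  induction n with
  | zero => simp [qShiftHom]
  | succ n ih =>
    rw [qShiftHom_succ, qShiftHom_succ, ih]
    ring

theorem qShiftHom_self (a p : ℂ) (n : ℕ) : qShiftHom a p p n = qShiftScaled a p n := by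
  simp only [qShiftHom, qShiftScaled, pow_succ']

theorem qShiftScaled_add (a p : ℂ) (m n : ℕ) :
    qShiftScaled a p (m + n) = qShiftScaled a p m * qShiftHom a (p ^ (m + 1)) p n := by
  simp only [qShiftScaled, qShiftHom, Finset.prod_range_add]
  congr 1
  refine Finset.prod_congr rfl fun k _ => ?_
  ring

theorem exists_norm_qShiftHom_mul_le (a b u v : ℂ) {p : ℂ} (hp : ‖p‖ < 1) {ρ : ℝ}
    (h : ‖a * b‖ < ρ) :
    ∃ K, 0 ≤ K ∧ ∀ n, ‖qShiftHom a u p n * qShiftHom b v p n‖ ≤ K * ρ ^ n := by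
  refine exists_norm_le_mul_pow (c := fun n => (a - u * p ^ n) * (b - v * p ^ n)) (l := a * b)
    (fun n => ?_) ?_ h
  · rw [qShiftHom_succ, qShiftHom_succ]
    ring
  · have h0 := tendsto_pow_atTop_nhds_zero_of_norm_lt_one hp
    simpa using ((h0.const_mul u).const_sub a).mul ((h0.const_mul v).const_sub b)

/-- The terms of the homogeneous form of the series `₂φ₁(u/a, v/b; uv; p, ab)`. -/
noncomputable def qGaussTerm (p a b u v : ℂ) (n : ℕ) : ℂ :=
  qShiftHom a u p n * qShiftHom b v p n / (qShift p p n * qShift (u * v) p n)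

section QGauss

variable {p a b u v : ℂ}

/-- The bound is uniform in `N`, as dominated convergence requires. Homogeneity extracts `(p^N)^n`,
and `(uv p^N; p)_n = (uv; p)_{N+n} / (uv; p)_N` keeps the denominators under control. -/
theorem exists_norm_qGaussTerm_le (hp : ‖p‖ < 1) (hab : ‖a * b‖ < 1) (huv : ‖u * v‖ < 1) :
    ∃ K ρ : ℝ, 0 ≤ K ∧ 0 ≤ ρ ∧ ρ < 1 ∧ ∀ N n,
      ‖qGaussTerm p (a * p ^ N) b (u * p ^ N) v n‖ ≤ (‖p‖ ^ N) ^ n * (K * ρ ^ n) := by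
  obtain ⟨ρ, hρ, hρ1⟩ := exists_between hab
  obtain ⟨K₁, hK₁, h₁⟩ := exists_norm_qShiftHom_mul_le a b u v hp hρ
  obtain ⟨K₂, hK₂, h₂⟩ := exists_norm_inv_qShift_le hp hp
  obtain ⟨K₃, hK₃, h₃⟩ := exists_norm_inv_qShift_le huv hp
  obtain ⟨K₄, hK₄, h₄⟩ := exists_norm_qShift_le (u * v) hp
  have hρ0 : 0 ≤ ρ := (norm_nonneg _).trans hρ.le
  refine ⟨K₁ * (K₂ * (K₄ * K₃)), ρ, by positivity, hρ0, hρ1, fun N n => ?_⟩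
  have e : qGaussTerm p (a * p ^ N) b (u * p ^ N) v n = (p ^ N) ^ n *
      ((qShiftHom a u p n * qShiftHom b v p n) * ((qShift p p n)⁻¹ *
        (qShift (u * v) p N * (qShift (u * v) p (N + n))⁻¹))) := by
    have h0 := qShift_ne_zero huv hp N
    rw [qGaussTerm, qShiftHom_mul, qShift_add, show u * p ^ N * v = u * v * p ^ N by ring]
    field_simp
  rw [e, norm_mul, norm_pow, norm_pow, norm_mul, norm_mul (_)⁻¹, norm_mul (qShift _ _ _)]
  calc _ ≤ (‖p‖ ^ N) ^ n * (K₁ * ρ ^ n * (K₂ * (K₄ * K₃))) := by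
        gcongr
        exacts [h₁ n, h₂ n, h₄ N, h₃ _]
    _ = _ := by ring

theorem summable_qGaussTerm (hp : ‖p‖ < 1) (hab : ‖a * b‖ < 1) (huv : ‖u * v‖ < 1) :
    Summable (qGaussTerm p a b u v) := by
  obtain ⟨K, ρ, -, hρ, hρ1, h⟩ := exists_norm_qGaussTerm_le hp hab huv
  refine .of_norm_bounded ((summable_geometric_of_lt_one hρ hρ1).mul_left K) fun n => ?_
  simpa using h 0 n

theorem norm_mul_pow_lt_one {x p : ℂ} (hx : ‖x‖ < 1) (hp : ‖p‖ < 1) (n : ℕ) :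
    ‖x * p ^ n‖ < 1 := by
  rw [norm_mul, norm_pow]
  exact mul_lt_one_of_nonneg_of_lt_one_left (norm_nonneg _) hx (pow_le_one₀ (norm_nonneg _) hp.le)

/-- A contiguous relation proved by telescoping: the termwise difference of the two sides is `G n -
G (n + 1)`, where `G 0 = 0` because of the factor `1 - p^n`, and `G n → 0` by summability. -/
theorem tsum_qGaussTerm_step (hp : ‖p‖ < 1) (hab : ‖a * b‖ < 1) (huv : ‖u * v‖ < 1) :
    (1 - u * v) * (1 - a * b) * ∑' n, qGaussTerm p a b u v n =
      (1 - a * v) * (1 - b * u) * ∑' n, qGaussTerm p (a * p) b (u * p) v n := by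
  have huv1 : ‖u * p * v‖ < 1 := by
    rw [mul_right_comm]
    simpa using norm_mul_pow_lt_one huv hp 1
  have hab1 : ‖a * p * b‖ < 1 := by
    rw [mul_right_comm]
    simpa using norm_mul_pow_lt_one hab hp 1
  have hs := summable_qGaussTerm hp hab huv
  have hs1 := summable_qGaussTerm hp hab1 huv1
  set G : ℕ → ℂ := fun n => (1 - u * v) * (1 - p ^ n) * qGaussTerm p a b u v n with hG
  have key : ∀ n, (1 - u * v) * (1 - a * b) * qGaussTerm p a b u v n -
      (1 - a * v) * (1 - b * u) * qGaussTerm p (a * p) b (u * p) v n = G n - G (n + 1) := by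
    intro n
    have h1 := qShift_ne_zero hp hp n
    have h2 := qShift_ne_zero huv1 hp n
    have h3 := one_sub_mul_pow_ne_zero huv hp 0
    have h4 := one_sub_mul_pow_ne_zero huv hp n
    have h5 := one_sub_mul_pow_ne_zero hp hp n
    have h6 : qShift (u * v) p n * (1 - u * v * p ^ n) = (1 - u * v) * qShift (u * p * v) p n := by
      rw [← qShift_succ, qShift_succ', mul_right_comm u v p]
    have h7 : qShift (u * v) p (n + 1) = (1 - u * v) * qShift (u * p * v) p n := by
      rw [qShift_succ', mul_right_comm u v p]
    have h8 : qShift (u * v) p n = (1 - u * v) * qShift (u * p * v) p n / (1 - u * v * p ^ n) := by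
      rw [eq_div_iff h4, h6]
    rw [pow_zero, mul_one] at h3
    simp only [hG, qGaussTerm]
    rw [qShiftHom_mul, qShiftHom_succ, qShiftHom_succ, qShift_succ p, h7, h8]
    rw [pow_succ']
    field_simp
    ring
  have hG0 : Tendsto G atTop (𝓝 0) := by
    have h0 := tendsto_pow_atTop_nhds_zero_of_norm_lt_one hp
    simpa [hG] using (((h0.const_sub 1).const_mul (1 - u * v)).mul hs.tendsto_atTop_zero)
  have hsub : HasSum (fun n => G n - G (n + 1)) (G 0) := by
    have hsum : Summable fun n => G n - G (n + 1) :=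
      ((hs.mul_left _).sub (hs1.mul_left _)).congr key
    rw [hsum.hasSum_iff_tendsto_nat]
    simp only [Finset.sum_range_sub']
    simpa using hG0.const_sub (G 0)
  have h0 := ((hs.hasSum.mul_left ((1 - u * v) * (1 - a * b))).sub
    (hs1.hasSum.mul_left ((1 - a * v) * (1 - b * u)))).unique (by simpa only [key] using hsub)
  rw [← sub_eq_zero, h0]
  simp [hG]

theorem tsum_qGaussTerm_iterate (hp : ‖p‖ < 1) (hab : ‖a * b‖ < 1) (huv : ‖u * v‖ < 1) (N : ℕ) :
    qShift (u * v) p N * qShift (a * b) p N * ∑' n, qGaussTerm p a b u v n =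
      qShift (a * v) p N * qShift (b * u) p N *
        ∑' n, qGaussTerm p (a * p ^ N) b (u * p ^ N) v n := by
  induction N with
  | zero => simp [qShift_zero]
  | succ N ih =>
    have hab1 : ‖a * p ^ N * b‖ < 1 := by
      rw [mul_right_comm]
      exact norm_mul_pow_lt_one hab hp N
    have huv1 : ‖u * p ^ N * v‖ < 1 := by
      rw [mul_right_comm]
      exact norm_mul_pow_lt_one huv hp N
    have h := tsum_qGaussTerm_step hp hab1 huv1
    simp only [qShift_succ]
    rw [show a * p ^ (N + 1) = a * p ^ N * p by ring, show u * p ^ (N + 1) = u * p ^ N * p by ring]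
    linear_combination (1 - u * v * p ^ N) * (1 - a * b * p ^ N) * ih +
      qShift (a * v) p N * qShift (b * u) p N * h

/-- The `q`-Gauss sum in homogeneous form. -/
theorem tsum_qGaussTerm (hp : ‖p‖ < 1) (hab : ‖a * b‖ < 1) (huv : ‖u * v‖ < 1) :
    ∑' n, qGaussTerm p a b u v n =
      qShiftInf (a * v) p * qShiftInf (b * u) p / (qShiftInf (u * v) p * qShiftInf (a * b) p) := by
  -- Iterating the step sends `a p^N` and `u p^N` to `0`, and only the term `n = 0` survives.
  have hlim : Tendsto (fun N : ℕ => ∑' n, qGaussTerm p (a * p ^ N) b (u * p ^ N) v n) atTop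
      (𝓝 (∑' n : ℕ, if n = 0 then 1 else 0)) := by
    obtain ⟨K, ρ, hK, hρ, hρ1, h⟩ := exists_norm_qGaussTerm_le hp hab huv
    refine tendsto_tsum_of_dominated_convergence
      ((summable_geometric_of_lt_one hρ hρ1).mul_left K) (fun n => ?_) (.of_forall fun N n => ?_)
    · rcases eq_or_ne n 0 with rfl | hn
      · simp [qGaussTerm, qShiftHom_zero, qShift_zero]
      · rw [if_neg hn]
        refine squeeze_zero_norm (a := fun N => ‖p‖ ^ N * (K * ρ ^ n)) (fun N => ?_) ?_
        · refine (h N n).trans ?_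
          gcongr
          exact pow_le_of_le_one (by positivity) (pow_le_one₀ (norm_nonneg _) hp.le) hn
        · simpa using (tendsto_pow_atTop_nhds_zero_of_lt_one (norm_nonneg p) hp).mul_const
            (K * ρ ^ n)
    · refine (h N n).trans (mul_le_of_le_one_left (by positivity) ?_)
      exact pow_le_one₀ (by positivity) (pow_le_one₀ (norm_nonneg _) hp.le)
  rw [tsum_ite_eq] at hlim
  have h1 := (((tendsto_qShift (u * v) hp).mul (tendsto_qShift (a * b) hp)).mul_const
    (∑' n, qGaussTerm p a b u v n))
  have h2 := ((tendsto_qShift (a * v) hp).mul (tendsto_qShift (b * u) hp)).mul hlim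
  have h3 := tendsto_nhds_unique (h1.congr (tsum_qGaussTerm_iterate hp hab huv)) h2
  rw [eq_div_iff (mul_ne_zero (qShiftInf_ne_zero huv hp) (qShiftInf_ne_zero hab hp))]
  linear_combination h3

end QGauss

/-! ### Bailey's transform: exchanging the double series -/

theorem norm_sq_lt_one {q : ℂ} (hq : ‖q‖ < 1) : ‖q ^ 2‖ < 1 := by
  rw [norm_pow]
  exact pow_lt_one₀ (norm_nonneg q) hq two_ne_zero

theorem norm_slaterAlpha_le {q : ℂ} (hq : ‖q‖ < 1) (r : ℕ) : ‖slaterAlpha q r‖ ≤ 2 := by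
  have hpow : ∀ m : ℕ, ‖q ^ m‖ ≤ 1 := fun m => by
    rw [norm_pow]
    exact pow_le_one₀ (norm_nonneg q) hq.le
  have h : ∀ k m n : ℕ, ‖(-1) ^ k * (1 + q ^ m) * q ^ n‖ ≤ 2 := fun k m n => by
    rw [norm_mul, norm_mul, norm_pow, norm_neg, norm_one, one_pow, one_mul]
    have h1 : ‖1 + q ^ m‖ ≤ 1 + 1 :=
      (norm_add_le _ _).trans (by rw [norm_one]; linarith [hpow m])
    nlinarith [hpow n, norm_nonneg (q ^ n), norm_nonneg (1 + q ^ m)]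
  unfold slaterAlpha
  split_ifs
  · exact h _ _ _
  · rw [norm_neg]
    exact h _ _ _

section Transform

variable {q a b : ℂ}

/-- The double series behind the transformation of `∑ D_N(a) D_N(b) β_N`. -/
noncomputable def baileyTerm (q a b : ℂ) (N r : ℕ) : ℂ :=
  qShiftScaled a (q ^ 2) N * qShiftScaled b (q ^ 2) N *
    (slaterAlpha q r * (qFactInv (q ^ 2) (N - r) * qFactInv (q ^ 2) (N + r + 1)))

theorem summable_baileyTerm (hq : ‖q‖ < 1) (hab : ‖a * b‖ < 1) :
    Summable (Function.uncurry (baileyTerm q a b)) := by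
  have hp := norm_sq_lt_one hq
  obtain ⟨ρ, hρ, hρ1⟩ := exists_between hab
  have hρ0 : 0 ≤ ρ := (norm_nonneg _).trans hρ.le
  obtain ⟨K, hK, h⟩ := exists_norm_qShiftHom_mul_le a b (q ^ 2) (q ^ 2) hp hρ
  simp only [qShiftHom_self] at h
  obtain ⟨L, hL, hL'⟩ := exists_norm_qFactInv_le hp
  -- Nonzero terms have `r ≤ N`, so `ρ^N = σ^N σ^N ≤ σ^N σ^r`, which is summable in both indices.
  set σ := √ρ with hσ
  have hσ0 : 0 ≤ σ := Real.sqrt_nonneg ρ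
  have hσ2 : ρ = σ ^ 2 := (Real.sq_sqrt hρ0).symm
  have hσ1 : σ < 1 := by
    rw [hσ, Real.sqrt_lt' one_pos]
    simpa using hρ1
  have hg := summable_geometric_of_lt_one hσ0 hσ1
  have hgg := (hg.mul_of_nonneg hg (fun n => pow_nonneg hσ0 n)
    (fun n => pow_nonneg hσ0 n)).mul_left (K * (2 * (L * L)))
  refine .of_norm_bounded hgg ?_
  rintro ⟨N, r⟩
  simp only [Function.uncurry, baileyTerm]
  rcases lt_or_ge N r with hNr | hNr
  · rw [qFactInv_of_neg _ (show (N - r : ℤ) < 0 by omega)]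
    simp only [zero_mul, mul_zero, norm_zero]
    positivity
  · rw [norm_mul, norm_mul (slaterAlpha q r), norm_mul (qFactInv _ _)]
    calc _ ≤ K * ρ ^ N * (2 * (L * L)) := by
          gcongr
          exacts [h N, norm_slaterAlpha_le hq r, hL' _, hL' _]
      _ = K * (2 * (L * L)) * (σ ^ N * σ ^ N) := by
          rw [hσ2]
          ring
      _ ≤ _ := by
          gcongr 2
          exact pow_le_pow_of_le_one hσ0 hσ1.le hNr

theorem tsum_baileyTerm_right (hq : ‖q‖ < 1) (N : ℕ) :
    ∑' r, baileyTerm q a b N r = qShiftScaled a (q ^ 2) N * qShiftScaled b (q ^ 2) N /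
      (qShift (-q) (q ^ 2) N * qShift (q ^ 2) (q ^ 2) N * qShift q (q ^ 2) (N + 1)) := by
  simp only [baileyTerm]
  rw [tsum_mul_left, tsum_slaterAlpha hq, mul_one_div]

/-- With `N = r + m`, the denominator splits as `(p; p)_{2r+1+m} = (p; p)_{2r+1} (p^(2r+2); p)_m`.
The sum over `m` is then the `q`-Gauss series with `u = v = p^(r+1)`, and `(p; p)_{2r+1}` is
absorbed into `(p; p)_∞`. -/
theorem tsum_baileyTerm_left (hq : ‖q‖ < 1) (hab : ‖a * b‖ < 1) (r : ℕ) :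
    ∑' N, baileyTerm q a b N r = slaterAlpha q r *
      (qShiftScaled a (q ^ 2) r * qShiftScaled b (q ^ 2) r) *
      (qShiftInf (a * q ^ 2 * (q ^ 2) ^ r) (q ^ 2) * qShiftInf (b * q ^ 2 * (q ^ 2) ^ r) (q ^ 2) /
        (qShiftInf (q ^ 2) (q ^ 2) * qShiftInf (a * b) (q ^ 2))) := by
  have hp := norm_sq_lt_one hq
  have hs : Summable fun N => baileyTerm q a b N r :=
    (summable_baileyTerm hq hab).comp_injective (i := fun N => (N, r))
      fun m n h => (Prod.mk.inj h).1
  set p := q ^ 2 with hp'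
  have huv : ‖p ^ (r + 1) * p ^ (r + 1)‖ < 1 := by
    rw [← pow_add, norm_pow]
    exact pow_lt_one₀ (norm_nonneg p) hp (by omega)
  have h0 : ∑ N ∈ Finset.range r, baileyTerm q a b N r = 0 := by
    refine Finset.sum_eq_zero fun N hN => ?_
    rw [Finset.mem_range] at hN
    rw [baileyTerm, qFactInv_of_neg _ (show (N - r : ℤ) < 0 by omega)]
    ring
  have hterm : ∀ m, baileyTerm q a b (m + r) r = slaterAlpha q r *
      (qShiftScaled a p r * qShiftScaled b p r) * (qShift p p (2 * r + 1))⁻¹ *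
      qGaussTerm p a b (p ^ (r + 1)) (p ^ (r + 1)) m := by
    intro m
    rw [baileyTerm, ← hp', show ((m + r : ℕ) - r : ℤ) = (m : ℕ) by push_cast; ring,
      show ((m + r : ℕ) + r + 1 : ℤ) = (2 * r + 1 + m : ℕ) by push_cast; ring,
      qFactInv_natCast, qFactInv_natCast, add_comm m r, qShiftScaled_add, qShiftScaled_add,
      qShift_add, qGaussTerm, show p * p ^ (2 * r + 1) = p ^ (r + 1) * p ^ (r + 1) by ring,
      mul_inv, div_eq_mul_inv, mul_inv]
    ring
  rw [← hs.sum_add_tsum_nat_add r, h0, zero_add, tsum_congr hterm, tsum_mul_left,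
    tsum_qGaussTerm hp hab huv, qShiftInf_eq_mul p hp (2 * r + 1),
    show p * p ^ (2 * r + 1) = p ^ (r + 1) * p ^ (r + 1) by ring,
    show a * p * p ^ r = a * p ^ (r + 1) by ring, show b * p * p ^ r = b * p ^ (r + 1) by ring,
    mul_assoc (qShift p p (2 * r + 1)), div_eq_mul_inv, div_eq_mul_inv, mul_inv (qShift p p _)]
  ring

theorem summable_qShiftScaled_div (hq : ‖q‖ < 1) (hab : ‖a * b‖ < 1) :
    Summable (fun n : ℕ => qShiftScaled a (q ^ 2) n * qShiftScaled b (q ^ 2) n /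
      (qShift (-q) (q ^ 2) n * qShift (q ^ 2) (q ^ 2) n * qShift q (q ^ 2) (n + 1))) :=
  (summable_baileyTerm hq hab).prod.congr fun N => tsum_baileyTerm_right hq N

theorem summable_slaterAlpha_mul (hq : ‖q‖ < 1) (ha : ‖a * q ^ 2‖ < 1) (hb : ‖b * q ^ 2‖ < 1)
    (hab : ‖a * b‖ < 1) :
    Summable fun r => slaterAlpha q r * (qShiftScaled a (q ^ 2) r * qShiftScaled b (q ^ 2) r /
      (qShift (a * q ^ 2) (q ^ 2) r * qShift (b * q ^ 2) (q ^ 2) r)) := by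
  have hp := norm_sq_lt_one hq
  obtain ⟨ρ, hρ, hρ1⟩ := exists_between hab
  have hρ0 : 0 ≤ ρ := (norm_nonneg _).trans hρ.le
  obtain ⟨K, hK, h⟩ := exists_norm_qShiftHom_mul_le a b (q ^ 2) (q ^ 2) hp hρ
  simp only [qShiftHom_self] at h
  obtain ⟨L, hL, hL'⟩ := exists_norm_inv_qShift_le ha hp
  obtain ⟨M, hM, hM'⟩ := exists_norm_inv_qShift_le hb hp
  refine .of_norm_bounded
    ((summable_geometric_of_lt_one hρ0 hρ1).mul_left (2 * (K * (L * M)))) fun r => ?_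
  rw [div_eq_mul_inv, mul_inv, norm_mul, norm_mul (_ * _), norm_mul (_)⁻¹]
  calc _ ≤ 2 * (K * ρ ^ r * (L * M)) := by
        gcongr
        exacts [norm_slaterAlpha_le hq r, h r, hL' r, hM' r]
    _ = _ := by ring

/-- The transformation before the right-hand side is split by the parity of the index. -/
theorem tsum_qShiftScaled_transform (hq : ‖q‖ < 1) (ha : ‖a * q ^ 2‖ < 1)
    (hb : ‖b * q ^ 2‖ < 1) (hab : ‖a * b‖ < 1) :
    qShiftInf (q ^ 2) (q ^ 2) * qShiftInf (a * b) (q ^ 2) /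
        (qShiftInf (a * q ^ 2) (q ^ 2) * qShiftInf (b * q ^ 2) (q ^ 2)) *
      ∑' n : ℕ, qShiftScaled a (q ^ 2) n * qShiftScaled b (q ^ 2) n /
        (qShift (-q) (q ^ 2) n * qShift (q ^ 2) (q ^ 2) n * qShift q (q ^ 2) (n + 1)) =
    ∑' r, slaterAlpha q r * (qShiftScaled a (q ^ 2) r * qShiftScaled b (q ^ 2) r /
      (qShift (a * q ^ 2) (q ^ 2) r * qShift (b * q ^ 2) (q ^ 2) r)) := by
  have hp := norm_sq_lt_one hq
  rw [← tsum_congr fun N => tsum_baileyTerm_right (a := a) (b := b) hq N,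
    ← (summable_baileyTerm hq hab).tsum_comm, ← tsum_mul_left]
  refine tsum_congr fun r => ?_
  -- Splitting `(ap; p)_∞ = (ap; p)_r (ap^(r+1); p)_∞`, and likewise for `b`, cancels the infinite
  -- tails and leaves the finite denominators.
  rw [tsum_baileyTerm_left hq hab, qShiftInf_eq_mul (a * q ^ 2) hp r,
    qShiftInf_eq_mul (b * q ^ 2) hp r]
  have h1 := qShiftInf_ne_zero hp hp
  have h2 := qShiftInf_ne_zero hab hp
  have h3 := qShift_ne_zero ha hp r
  have h4 := qShift_ne_zero hb hp r
  have h5 := qShiftInf_ne_zero (norm_mul_pow_lt_one ha hp r) hp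
  have h6 := qShiftInf_ne_zero (norm_mul_pow_lt_one hb hp r) hp
  generalize qShiftInf (a * q ^ 2 * (q ^ 2) ^ r) (q ^ 2) = x at h5 ⊢
  generalize qShiftInf (b * q ^ 2 * (q ^ 2) ^ r) (q ^ 2) = y at h6 ⊢
  generalize qShift (a * q ^ 2) (q ^ 2) r = z at h3 ⊢
  generalize qShift (b * q ^ 2) (q ^ 2) r = w at h4 ⊢
  field_simp

/-! ### Splitting by parity and the final statement -/

theorem qShiftScaled_identity (hq : ‖q‖ < 1) (ha : ‖a * q ^ 2‖ < 1) (hb : ‖b * q ^ 2‖ < 1)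
    (hab : ‖a * b‖ < 1) :
    Summable (fun n : ℕ =>
        qShiftScaled a (q ^ 2) n * qShiftScaled b (q ^ 2) n /
          (qShift (-q) (q ^ 2) n * qShift (q ^ 2) (q ^ 2) n * qShift q (q ^ 2) (n + 1))) ∧
      Summable (fun n : ℕ =>
        (-1) ^ n * (1 + q ^ (4 * n + 1)) *
          (qShiftScaled a (q ^ 2) (2 * n) * qShiftScaled b (q ^ 2) (2 * n) /
            (qShift (a * q ^ 2) (q ^ 2) (2 * n) * qShift (b * q ^ 2) (q ^ 2) (2 * n))) *
          q ^ (6 * n ^ 2 + 2 * n)) ∧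
      Summable (fun n : ℕ =>
        (-1) ^ n * (1 + q ^ (4 * n + 3)) *
          (qShiftScaled a (q ^ 2) (2 * n + 1) * qShiftScaled b (q ^ 2) (2 * n + 1) /
            (qShift (a * q ^ 2) (q ^ 2) (2 * n + 1) * qShift (b * q ^ 2) (q ^ 2) (2 * n + 1))) *
          q ^ (6 * n ^ 2 + 6 * n + 1)) ∧
      qShiftInf (q ^ 2) (q ^ 2) * qShiftInf (a * b) (q ^ 2) /
          (qShiftInf (a * q ^ 2) (q ^ 2) * qShiftInf (b * q ^ 2) (q ^ 2)) *
        ∑' n : ℕ,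
          qShiftScaled a (q ^ 2) n * qShiftScaled b (q ^ 2) n /
            (qShift (-q) (q ^ 2) n * qShift (q ^ 2) (q ^ 2) n * qShift q (q ^ 2) (n + 1)) =
      (∑' n : ℕ,
        (-1) ^ n * (1 + q ^ (4 * n + 1)) *
          (qShiftScaled a (q ^ 2) (2 * n) * qShiftScaled b (q ^ 2) (2 * n) /
            (qShift (a * q ^ 2) (q ^ 2) (2 * n) * qShift (b * q ^ 2) (q ^ 2) (2 * n))) *
          q ^ (6 * n ^ 2 + 2 * n)) -
      ∑' n : ℕ,
        (-1) ^ n * (1 + q ^ (4 * n + 3)) *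
          (qShiftScaled a (q ^ 2) (2 * n + 1) * qShiftScaled b (q ^ 2) (2 * n + 1) /
            (qShift (a * q ^ 2) (q ^ 2) (2 * n + 1) * qShift (b * q ^ 2) (q ^ 2) (2 * n + 1))) *
          q ^ (6 * n ^ 2 + 6 * n + 1) := by
  have hs := summable_slaterAlpha_mul hq ha hb hab
  have ht := tsum_qShiftScaled_transform hq ha hb hab
  set f : ℕ → ℂ := fun r => slaterAlpha q r *
    (qShiftScaled a (q ^ 2) r * qShiftScaled b (q ^ 2) r /
      (qShift (a * q ^ 2) (q ^ 2) r * qShift (b * q ^ 2) (q ^ 2) r)) with hf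
  have hs1 : Summable fun n => f (2 * n) :=
    hs.comp_injective (i := fun n => 2 * n) fun m n h => by simpa using h
  have hs2 : Summable fun n => f (2 * n + 1) :=
    hs.comp_injective (i := fun n => 2 * n + 1) fun m n h => by simpa using h
  have he : ∀ n, f (2 * n) = (-1) ^ n * (1 + q ^ (4 * n + 1)) *
      (qShiftScaled a (q ^ 2) (2 * n) * qShiftScaled b (q ^ 2) (2 * n) /
        (qShift (a * q ^ 2) (q ^ 2) (2 * n) * qShift (b * q ^ 2) (q ^ 2) (2 * n))) *
      q ^ (6 * n ^ 2 + 2 * n) := fun n => by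
    rw [hf]
    beta_reduce
    rw [slaterAlpha_even, mul_right_comm]
  have ho : ∀ n, -f (2 * n + 1) = (-1) ^ n * (1 + q ^ (4 * n + 3)) *
      (qShiftScaled a (q ^ 2) (2 * n + 1) * qShiftScaled b (q ^ 2) (2 * n + 1) /
        (qShift (a * q ^ 2) (q ^ 2) (2 * n + 1) * qShift (b * q ^ 2) (q ^ 2) (2 * n + 1))) *
      q ^ (6 * n ^ 2 + 6 * n + 1) := fun n => by
    rw [hf]
    beta_reduce
    rw [slaterAlpha_odd, neg_mul, neg_neg, mul_right_comm]
  refine ⟨summable_qShiftScaled_div hq hab, hs1.congr he, hs2.neg.congr ho, ?_⟩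
  rw [ht, ← tsum_congr he, ← tsum_congr ho, tsum_neg, sub_neg_eq_add, tsum_even_add_odd hs1 hs2]

end Transform

theorem theoremT9 (q a b : ℂ) (hq : ‖q‖ < 1) (ha : ‖a * q ^ 2‖ < 1) (hb : ‖b * q ^ 2‖ < 1)
    (hab : ‖a * b‖ < 1) :
    -- the identity for nonzero `a` and `b`, with all three series converging absolutely
    (a ≠ 0 → b ≠ 0 →
      Summable (fun n : ℕ =>
        qShift (q ^ 2 / a) (q ^ 2) n * qShift (q ^ 2 / b) (q ^ 2) n /
          (qShift (-q) (q ^ 2) n * qShift (q ^ 2) (q ^ 2) n * qShift q (q ^ 2) (n + 1)) *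
          a ^ n * b ^ n) ∧
      Summable (fun n : ℕ =>
        (-1) ^ n * (1 + q ^ (4 * n + 1)) *
          (qShift (q ^ 2 / a) (q ^ 2) (2 * n) * qShift (q ^ 2 / b) (q ^ 2) (2 * n) /
            (qShift (a * q ^ 2) (q ^ 2) (2 * n) * qShift (b * q ^ 2) (q ^ 2) (2 * n))) *
          (a * b) ^ (2 * n) * q ^ (6 * n ^ 2 + 2 * n)) ∧
      Summable (fun n : ℕ =>
        (-1) ^ n * (1 + q ^ (4 * n + 3)) *
          (qShift (q ^ 2 / a) (q ^ 2) (2 * n + 1) * qShift (q ^ 2 / b) (q ^ 2) (2 * n + 1) /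
            (qShift (a * q ^ 2) (q ^ 2) (2 * n + 1) * qShift (b * q ^ 2) (q ^ 2) (2 * n + 1))) *
          (a * b) ^ (2 * n + 1) * q ^ (6 * n ^ 2 + 6 * n + 1)) ∧
      qShiftInf (q ^ 2) (q ^ 2) * qShiftInf (a * b) (q ^ 2) /
          (qShiftInf (a * q ^ 2) (q ^ 2) * qShiftInf (b * q ^ 2) (q ^ 2)) *
        ∑' n : ℕ,
          qShift (q ^ 2 / a) (q ^ 2) n * qShift (q ^ 2 / b) (q ^ 2) n /
            (qShift (-q) (q ^ 2) n * qShift (q ^ 2) (q ^ 2) n * qShift q (q ^ 2) (n + 1)) *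
            a ^ n * b ^ n =
      (∑' n : ℕ,
        (-1) ^ n * (1 + q ^ (4 * n + 1)) *
          (qShift (q ^ 2 / a) (q ^ 2) (2 * n) * qShift (q ^ 2 / b) (q ^ 2) (2 * n) /
            (qShift (a * q ^ 2) (q ^ 2) (2 * n) * qShift (b * q ^ 2) (q ^ 2) (2 * n))) *
          (a * b) ^ (2 * n) * q ^ (6 * n ^ 2 + 2 * n)) -
      ∑' n : ℕ,
        (-1) ^ n * (1 + q ^ (4 * n + 3)) *
          (qShift (q ^ 2 / a) (q ^ 2) (2 * n + 1) * qShift (q ^ 2 / b) (q ^ 2) (2 * n + 1) /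
            (qShift (a * q ^ 2) (q ^ 2) (2 * n + 1) * qShift (b * q ^ 2) (q ^ 2) (2 * n + 1))) *
          (a * b) ^ (2 * n + 1) * q ^ (6 * n ^ 2 + 6 * n + 1)) ∧
    -- the same with `(q²/a; q²)_m a^m` and `(q²/b; q²)_m b^m` read as limits at `a = 0`, `b = 0`
    (Summable (fun n : ℕ =>
        qShiftScaled a (q ^ 2) n * qShiftScaled b (q ^ 2) n /
          (qShift (-q) (q ^ 2) n * qShift (q ^ 2) (q ^ 2) n * qShift q (q ^ 2) (n + 1))) ∧
      Summable (fun n : ℕ =>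
        (-1) ^ n * (1 + q ^ (4 * n + 1)) *
          (qShiftScaled a (q ^ 2) (2 * n) * qShiftScaled b (q ^ 2) (2 * n) /
            (qShift (a * q ^ 2) (q ^ 2) (2 * n) * qShift (b * q ^ 2) (q ^ 2) (2 * n))) *
          q ^ (6 * n ^ 2 + 2 * n)) ∧
      Summable (fun n : ℕ =>
        (-1) ^ n * (1 + q ^ (4 * n + 3)) *
          (qShiftScaled a (q ^ 2) (2 * n + 1) * qShiftScaled b (q ^ 2) (2 * n + 1) /
            (qShift (a * q ^ 2) (q ^ 2) (2 * n + 1) * qShift (b * q ^ 2) (q ^ 2) (2 * n + 1))) *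
          q ^ (6 * n ^ 2 + 6 * n + 1)) ∧
      qShiftInf (q ^ 2) (q ^ 2) * qShiftInf (a * b) (q ^ 2) /
          (qShiftInf (a * q ^ 2) (q ^ 2) * qShiftInf (b * q ^ 2) (q ^ 2)) *
        ∑' n : ℕ,
          qShiftScaled a (q ^ 2) n * qShiftScaled b (q ^ 2) n /
            (qShift (-q) (q ^ 2) n * qShift (q ^ 2) (q ^ 2) n * qShift q (q ^ 2) (n + 1)) =
      (∑' n : ℕ,
        (-1) ^ n * (1 + q ^ (4 * n + 1)) *
          (qShiftScaled a (q ^ 2) (2 * n) * qShiftScaled b (q ^ 2) (2 * n) /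
            (qShift (a * q ^ 2) (q ^ 2) (2 * n) * qShift (b * q ^ 2) (q ^ 2) (2 * n))) *
          q ^ (6 * n ^ 2 + 2 * n)) -
      ∑' n : ℕ,
        (-1) ^ n * (1 + q ^ (4 * n + 3)) *
          (qShiftScaled a (q ^ 2) (2 * n + 1) * qShiftScaled b (q ^ 2) (2 * n + 1) /
            (qShift (a * q ^ 2) (q ^ 2) (2 * n + 1) * qShift (b * q ^ 2) (q ^ 2) (2 * n + 1))) *
          q ^ (6 * n ^ 2 + 6 * n + 1)) := by

  have h := qShiftScaled_identity hq ha hb hab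
  refine ⟨fun ha0 hb0 => ?_, h⟩
  -- For nonzero parameters the scaled identity is the stated one, up to regrouping the powers of
  -- `a` and `b`.
  simp only [qShiftScaled_of_ne_zero ha0, qShiftScaled_of_ne_zero hb0] at h
  obtain ⟨h1, h2, h3, h4⟩ := h
  refine ⟨h1.congr fun n => by ring, h2.congr fun n => by ring, h3.congr fun n => by ring, ?_⟩
  refine Eq.trans ?_ (h4.trans ?_)
  · congr 1
    exact tsum_congr fun n => by ring
  · congr 1 <;> exact tsum_congr fun n => by ring
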